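/- For a finite poset $P$ let $c_k$ (resp. $a_k$) be the maximal cardinality of a union of $k$ chains (resp. antichains) of $P$, and let $\lambda(P)$ be the Young diagram whose $k$-th row has length $c_k-c_{k-1}$ and whose $k$-th column has length $a_k-a_{k-1}$ for all $k\ge 1$ (such a diagram exists by Greene's duality theorem; rows are numbered from top to bottom). Let $n \geq 0$, let $\sigma$ be a permutation of $[n]=\{1,\dots,n\}$, and let $P_\sigma=\{(k,\sigma(k)) : k\in[n]\}$ with the partial order induced from the product order: $(k,\sigma(k))\le(l,\sigma(l))$ if and only if $k\le l$ and $\sigma(k)\le\sigma(l)$. For $0\le i,j\le n$ put $\lambda_{ij}=\lambda\bigl(P_\sigma\cap([i]\times[j])\bigr)$, where $[0]=\varnothing$. Then every $\lambda_{ij}$ with $0\le i,j\le n$ is well defined, i.e. there is a Young diagram with the row lengths and the column lengths prescribed above. Moreover, for all $i,j\in\{1,\dots,n\}$ the shape $\lambda_{ij}$ is uniquely determined by $\lambda_{i-1,j-1}$, $\lambda_{i,j-1}$, $\lambda_{i-1,j}$ and whether or not $\sigma(i)=j$ (by a rule that does not depend on $n,\sigma,i,j$), namely as follows. 1. If $\lambda_{i,j-1}\neq\lambda_{i-1,j}$,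 then $\lambda_{ij}=\lambda_{i,j-1}\cup\lambda_{i-1,j}$. 2. If $\lambda_{i,j-1}=\lambda_{i-1,j}=\lambda_{i-1,j-1}$ and $\sigma(i)\neq j$, then $\lambda_{ij}=\lambda_{i-1,j-1}$. 3. If $\lambda_{i,j-1}=\lambda_{i-1,j}=\lambda_{i-1,j-1}$ and $\sigma(i)=j$, then $\lambda_{ij}$ is obtained by adding a box to the first row of $\lambda_{i-1,j-1}$. 4. If $\lambda_{i,j-1}=\lambda_{i-1,j}\neq\lambda_{i-1,j-1}$, then $\lambda_{i-1,j}$ is obtained from $\lambda_{i-1,j-1}$ by adding a single box $A$, and $\lambda_{ij}$ is obtained from $\lambda_{i-1,j}$ by adding a box to the row immediately below the row of $A$. -/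

import Mathlib

namespace Greene

section

variable {α : Type*} [PartialOrder α]

open Classical in
/-- `c_k`: the maximal cardinality of a union of `k` chains of the finite poset `P`
(with the order induced from the ambient partial order). -/
noncomputable def chainNum (P : Finset α) (k : ℕ) : ℕ :=
  (P.powerset.filter fun S : Finset α => ∃ C : Fin k → Set α,
    (∀ t, IsChain (· ≤ ·) (C t)) ∧ (S : Set α) = ⋃ t, C t).sup Finset.card

open Classical in
/-- `a_k`: the maximal cardinality of a union of `k` antichains of the finite poset `P`. -/
noncomputable def antichainNum (P : Finset α) (k : ℕ) : ℕ :=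
  (P.powerset.filter fun S : Finset α => ∃ A : Fin k → Set α,
    (∀ t, IsAntichain (· ≤ ·) (A t)) ∧ (S : Set α) = ⋃ t, A t).sup Finset.card

/-- `μ` is the shape of the finite poset `P`: its row lengths are `c_k - c_{k-1}` and its
column lengths are `a_k - a_{k-1}`, for `k ≥ 1`. (Rows and columns of a `YoungDiagram` are
numbered from `0`; both sequences `c` and `a` are weakly increasing.) -/
def IsShape (P : Finset α) (μ : YoungDiagram) : Prop :=
  (∀ k : ℕ, μ.rowLen k = chainNum P (k + 1) - chainNum P k) ∧
  (∀ k : ℕ, μ.colLen k = antichainNum P (k + 1) - antichainNum P k)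

open Classical in
/-- `λ(P)`: the Young diagram whose row lengths and column lengths are as in `IsShape`. A diagram
is determined by its row lengths, so there is at most one. That there is one, so that the default
value is not taken, is asserted explicitly wherever `shape` is used. -/
noncomputable def shape (P : Finset α) : YoungDiagram :=
  if h : ∃ μ : YoungDiagram, IsShape P μ then h.choose else ⊥

end

/-- The permutation poset `P_σ`: the points `(k, σ(k))`, `1 ≤ k ≤ n`, ordered as a subset of the
product `ℕ × ℕ`. The element `k : Fin n` stands for the number `k + 1` of `{1, …, n}`. -/
def permPoset {n : ℕ} (σ : Equiv.Perm (Fin n)) : Finset (ℕ × ℕ) :=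
  Finset.univ.image fun k : Fin n => ((k : ℕ) + 1, (σ k : ℕ) + 1)

/-- The order ideal `P_σ(i, j) = ([i] × [j]) ∩ P_σ`. -/
def permIdeal {n : ℕ} (σ : Equiv.Perm (Fin n)) (i j : ℕ) : Finset (ℕ × ℕ) :=
  (Finset.Icc 1 i ×ˢ Finset.Icc 1 j) ∩ permPoset σ

/-- The growth diagram `λ_{ij} = λ(P_σ(i, j))` of `σ`. -/
noncomputable def growth {n : ℕ} (σ : Equiv.Perm (Fin n)) (i j : ℕ) : YoungDiagram :=
  shape (permIdeal σ i j)

/-- `ν` is obtained from `μ` by adding the box `b`. -/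
def AddsBox (μ : YoungDiagram) (b : ℕ × ℕ) (ν : YoungDiagram) : Prop :=
  b ∉ μ ∧ ν.cells = insert b μ.cells

end Greene

/-!
A union of `k` chains or antichains is a set with a proper `k`-colouring, so `c_k` and `a_k` are
instances of one extremal quantity. The bound `c_h + a_k ≤ |P| + h k` holds because a chain and an
antichain share at most one element. Linear programming duality for an assignment problem that
encodes families of chains shows that for each `h` some `k` makes it an equality, and conversely.
This makes `c` concave and forces the column lengths of the resulting diagram to be the increments
of `a`.

For the local rules, the points with first coordinate `i` and with second coordinate `j` are maximal
in the product order and extremal, on opposite sides, in the northwest order, whose antichains are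
the chains of the poset. Labelling elements by their heights inside an optimal coloured set and
taking minima and maxima of two labellings gives exchange inequalities for `c` and for `a`. Adding
either point therefore adds one box to the shape. Two different boxes have to be both present in
`λ_{ij}`. If both points add the same box to the southwest shape, then the exchange inequality for
`c` puts the next box at most one row below it and the one for `a` puts it in no later column, hence
strictly below.
-/

namespace Greene

section Coloring

variable {α β : Type*}

/-- `f` colours `S` properly with the colours `0, …, k - 1`: elements related by `R` get distinct
colours. The colour classes are chains if `R` is incomparability and antichains if `R` is `<`. -/
structure IsColoring (R : α → α → Prop) (S : Finset α) (k : ℕ) (f : α → ℕ) : Prop where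
  lt : ∀ x ∈ S, f x < k
  ne : ∀ x ∈ S, ∀ y ∈ S, R x y → f x ≠ f y

open Classical in
/-- The maximal cardinality of a `k`-colourable subset of `P`; this is the common form of
`chainNum` and `antichainNum`. -/
noncomputable def colorNum (R : α → α → Prop) (P : Finset α) (k : ℕ) : ℕ :=
  (P.powerset.filter fun S => ∃ f, IsColoring R S k f).sup Finset.card

variable {R : α → α → Prop} {P Q S T : Finset α} {k l : ℕ} {f : α → ℕ}

theorem IsColoring.card_le_colorNum (hf : IsColoring R S k f) (hS : S ⊆ P) :
    S.card ≤ colorNum R P k := by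
  classical
  exact Finset.le_sup (f := Finset.card)
    (Finset.mem_filter.2 ⟨Finset.mem_powerset.2 hS, f, hf⟩)

theorem exists_isColoring_card_eq (R : α → α → Prop) (P : Finset α) (k : ℕ) :
    ∃ S ⊆ P, ∃ f, IsColoring R S k f ∧ S.card = colorNum R P k := by
  classical
  have hne : (P.powerset.filter fun S => ∃ f, IsColoring R S k f).Nonempty :=
    ⟨∅, Finset.mem_filter.2 ⟨Finset.empty_mem_powerset _, fun _ => 0, by simp, by simp⟩⟩
  obtain ⟨S, hS, hcard⟩ := Finset.exists_mem_eq_sup _ hne Finset.card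
  obtain ⟨hSP, f, hf⟩ := Finset.mem_filter.1 hS
  exact ⟨S, Finset.mem_powerset.1 hSP, f, hf, hcard.symm⟩

theorem IsColoring.subset (hf : IsColoring R S k f) (hT : T ⊆ S) : IsColoring R T k f :=
  ⟨fun x hx => hf.lt x (hT hx), fun x hx y hy => hf.ne x (hT hx) y (hT hy)⟩

theorem colorNum_mono (R : α → α → Prop) (P : Finset α) : Monotone (colorNum R P) := by
  intro k l hkl
  obtain ⟨S, hS, f, hf, hcard⟩ := exists_isColoring_card_eq R P k
  rw [← hcard]
  exact IsColoring.card_le_colorNum ⟨fun x hx => (hf.lt x hx).trans_le hkl, hf.ne⟩ hS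

theorem colorNum_le_of_subset (h : Q ⊆ P) : colorNum R Q k ≤ colorNum R P k := by
  obtain ⟨S, hS, f, hf, hcard⟩ := exists_isColoring_card_eq R Q k
  rw [← hcard]
  exact hf.card_le_colorNum (hS.trans h)

theorem colorNum_le_card : colorNum R P k ≤ P.card := by
  obtain ⟨S, hS, -, -, hcard⟩ := exists_isColoring_card_eq R P k
  rw [← hcard]
  exact Finset.card_le_card hS

theorem colorNum_zero : colorNum R P 0 = 0 := by
  obtain ⟨S, -, f, hf, hcard⟩ := exists_isColoring_card_eq R P 0
  rw [← hcard, Finset.card_eq_zero, Finset.eq_empty_iff_forall_notMem]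
  exact fun x hx => Nat.not_lt_zero _ (hf.lt x hx)

theorem card_le_colorNum_card {γ : Type*} (hS : S ⊆ P) (H : Finset γ) (c : S → γ)
    (hc : ∀ x, c x ∈ H) (hR : ∀ x y : S, R x y → c x ≠ c y) :
    S.card ≤ colorNum R P H.card := by
  classical
  have hmem : ∀ x, c x ∈ H.toList := fun x => Finset.mem_toList.2 (hc x)
  refine IsColoring.card_le_colorNum
    (f := fun x => if hx : x ∈ S then H.toList.idxOf (c ⟨x, hx⟩) else 0) ⟨?_, ?_⟩ hS
  · intro x hx
    simpa [hx] using List.idxOf_lt_length_of_mem (hmem ⟨x, hx⟩)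
  · intro x hx y hy hxy he
    simp only [hx, hy, dite_true] at he
    exact hR ⟨x, hx⟩ ⟨y, hy⟩ hxy ((List.idxOf_inj (hmem _)).1 he)

theorem colorNum_eq_card (hR : ∀ x, ¬ R x x) (h : P.card ≤ k) : colorNum R P k = P.card := by
  refine le_antisymm colorNum_le_card (le_trans ?_ (colorNum_mono R P h))
  exact card_le_colorNum_card subset_rfl P Subtype.val Subtype.prop
    fun x y hxy he => hR x (by rwa [← he] at hxy)

theorem colorNum_insert_le [DecidableEq α] (p : α) :
    colorNum R (insert p P) k ≤ colorNum R P k + 1 := by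
  obtain ⟨S, hS, f, hf, hcard⟩ := exists_isColoring_card_eq R (insert p P) k
  have hle : (S.erase p).card ≤ colorNum R P k :=
    (hf.subset (Finset.erase_subset _ _)).card_le_colorNum (Finset.subset_insert_iff.1 hS)
  have := Finset.pred_card_le_card_erase (s := S) (a := p)
  omega

theorem colorNum_insert_of_unrelated [DecidableEq α] {p : α} (hp : p ∉ P)
    (hR : ∀ x ∈ insert p P, ¬ R x p ∧ ¬ R p x) :
    colorNum R (insert p P) (k + 1) = colorNum R P (k + 1) + 1 := by
  refine le_antisymm (colorNum_insert_le p) ?_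
  obtain ⟨S, hS, f, hf, hcard⟩ := exists_isColoring_card_eq R P (k + 1)
  rw [← hcard, ← Finset.card_insert_of_notMem fun h => hp (hS h)]
  have hSP : insert p S ⊆ insert p P := Finset.insert_subset_insert p hS
  refine IsColoring.card_le_colorNum (f := Function.update f p 0) ⟨fun x hx => ?_, ?_⟩ hSP
  · rcases eq_or_ne x p with rfl | hxp
    · simp
    · rw [Function.update_of_ne hxp]
      exact hf.lt x (Finset.mem_of_mem_insert_of_ne hx hxp)
  · intro x hx y hy hxy
    have hxp : x ≠ p := by
      rintro rfl
      exact (hR y (hSP hy)).2 hxy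
    have hyp : y ≠ p := by
      rintro rfl
      exact (hR x (hSP hx)).1 hxy
    rw [Function.update_of_ne hxp, Function.update_of_ne hyp]
    exact hf.ne x (Finset.mem_of_mem_insert_of_ne hx hxp) y
      (Finset.mem_of_mem_insert_of_ne hy hyp) hxy

theorem colorNum_congr {R' : α → α → Prop} (h : ∀ x y, R x y ∨ R y x ↔ R' x y ∨ R' y x) :
    colorNum R P k = colorNum R' P k := by
  have hiff : ∀ S f, IsColoring R S k f ↔ IsColoring R' S k f := by
    have key : ∀ {R R' : α → α → Prop}, (∀ x y, R' x y ∨ R' y x → R x y ∨ R y x) →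
        ∀ {S f}, IsColoring R S k f → IsColoring R' S k f := by
      refine fun h S f hf => ⟨hf.lt, fun x hx y hy hxy => ?_⟩
      rcases h x y (Or.inl hxy) with h | h
      exacts [hf.ne x hx y hy h, (hf.ne y hy x hx h).symm]
    exact fun S f => ⟨key fun x y => (h x y).2, key fun x y => (h x y).1⟩
  unfold colorNum
  congr 1
  ext S
  simp only [Finset.mem_filter, hiff]

theorem colorNum_map (e : β ↪ α) (P : Finset β) :
    colorNum R (P.map e) k = colorNum (fun x y => R (e x) (e y)) P k := by
  apply le_antisymm
  · obtain ⟨S, hS, f, hf, hcard⟩ := exists_isColoring_card_eq R (P.map e) k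
    obtain ⟨T, hT, rfl⟩ := Finset.subset_map_iff.1 hS
    rw [← hcard, Finset.card_map]
    refine IsColoring.card_le_colorNum (f := f ∘ e) ⟨fun x hx => ?_, fun x hx y hy => ?_⟩ hT
    · exact hf.lt _ (Finset.mem_map_of_mem e hx)
    · exact hf.ne _ (Finset.mem_map_of_mem e hx) _ (Finset.mem_map_of_mem e hy)
  · obtain ⟨T, hT, f, hf, hcard⟩ := exists_isColoring_card_eq (fun x y => R (e x) (e y)) P k
    rw [← hcard, ← Finset.card_map e]
    refine IsColoring.card_le_colorNum (f := Function.extend e f 0) ⟨?_, ?_⟩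
      (Finset.map_subset_map.2 hT)
    · simpa [e.injective.extend_apply] using hf.lt
    · simpa [e.injective.extend_apply] using hf.ne

theorem exists_isColoring_iff :
    (∃ f, IsColoring R S k f) ↔ ∃ C : Fin k → Set α,
      (∀ t, ∀ x ∈ C t, ∀ y ∈ C t, ¬ R x y) ∧ (S : Set α) = ⋃ t, C t := by
  classical
  constructor
  · rintro ⟨f, hf⟩
    refine ⟨fun t => {x | x ∈ S ∧ f x = t}, ?_, ?_⟩
    · rintro t x ⟨hx, hxt⟩ y ⟨hy, hyt⟩ hxy
      exact hf.ne x hx y hy hxy (hxt.trans hyt.symm)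
    · ext x
      simp only [Set.mem_iUnion, Set.mem_ofPred_eq, Finset.mem_coe]
      exact ⟨fun h => ⟨⟨f x, hf.lt x h⟩, h, rfl⟩, fun ⟨_, h, _⟩ => h⟩
  · rintro ⟨C, hC, hS⟩
    have hmem : ∀ x : S, ∃ t, x.1 ∈ C t := fun x => Set.mem_iUnion.1 (hS ▸ x.2)
    choose t ht using hmem
    refine ⟨fun x => if h : x ∈ S then t ⟨x, h⟩ else 0, fun x hx => by simp [hx], ?_⟩
    intro x hx y hy hxy he
    simp only [hx, hy, dite_true, Fin.val_inj] at he
    exact hC _ x (ht ⟨x, hx⟩) y (he ▸ ht ⟨y, hy⟩) hxy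

variable [PartialOrder α] [PartialOrder β]

theorem chainNum_eq_colorNum (P : Finset α) (k : ℕ) :
    chainNum P k = colorNum (IncompRel (· ≤ ·)) P k := by
  have hchain : ∀ C : Set α, IsChain (· ≤ ·) C ↔ ∀ x ∈ C, ∀ y ∈ C, ¬ IncompRel (· ≤ ·) x y :=
    fun C => ⟨fun h x hx y hy hxy => (h.total hx hy).elim hxy.1 hxy.2,
      fun h x hx y hy _ => by simpa [IncompRel, or_iff_not_imp_left] using h x hx y hy⟩
  unfold chainNum colorNum
  congr 1
  ext S
  simp only [Finset.mem_filter, exists_isColoring_iff, hchain]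

theorem antichainNum_eq_colorNum (P : Finset α) (k : ℕ) :
    antichainNum P k = colorNum (· < ·) P k := by
  have hantichain : ∀ A : Set α, IsAntichain (· ≤ ·) A ↔ ∀ x ∈ A, ∀ y ∈ A, ¬ x < y :=
    fun A => ⟨fun h x hx y hy hxy => h hx hy hxy.ne hxy.le,
      fun h x hx y hy hne hle => h x hx y hy (hle.lt_of_ne hne)⟩
  unfold antichainNum colorNum
  congr 1
  ext S
  simp only [Finset.mem_filter, exists_isColoring_iff, hantichain]

theorem chainNum_map (e : α ↪o β) (P : Finset α) (k : ℕ) :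
    chainNum (P.map e.toEmbedding) k = chainNum P k := by
  simp only [chainNum_eq_colorNum, colorNum_map, RelEmbedding.coe_toEmbedding, IncompRel,
    OrderEmbedding.le_iff_le]
  rfl

theorem antichainNum_map (e : α ↪o β) (P : Finset α) (k : ℕ) :
    antichainNum (P.map e.toEmbedding) k = antichainNum P k := by
  simp [antichainNum_eq_colorNum, colorNum_map]

theorem chainNum_mono (P : Finset α) : Monotone (chainNum P) := by
  simpa only [Monotone, chainNum_eq_colorNum] using colorNum_mono (IncompRel (· ≤ ·)) P

theorem antichainNum_mono (P : Finset α) : Monotone (antichainNum P) := by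
  simpa only [Monotone, antichainNum_eq_colorNum] using colorNum_mono (· < ·) P

theorem chainNum_zero (P : Finset α) : chainNum P 0 = 0 := by
  rw [chainNum_eq_colorNum, colorNum_zero]

theorem antichainNum_zero (P : Finset α) : antichainNum P 0 = 0 := by
  rw [antichainNum_eq_colorNum, colorNum_zero]

theorem chainNum_le_card (P : Finset α) (k : ℕ) : chainNum P k ≤ P.card := by
  rw [chainNum_eq_colorNum]
  exact colorNum_le_card

theorem antichainNum_le_card (P : Finset α) (k : ℕ) : antichainNum P k ≤ P.card := by
  rw [antichainNum_eq_colorNum]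
  exact colorNum_le_card

theorem chainNum_eq_card {P : Finset α} (h : P.card ≤ k) : chainNum P k = P.card := by
  rw [chainNum_eq_colorNum, colorNum_eq_card (fun x hx => hx.1 le_rfl) h]

theorem antichainNum_eq_card {P : Finset α} (h : P.card ≤ k) : antichainNum P k = P.card := by
  rw [antichainNum_eq_colorNum, colorNum_eq_card lt_irrefl h]

end Coloring

section Assignment

variable {X : Type*} {R : X → X → Prop} {w : X → X → ℤ} {u v : X → ℤ}

/-- A feasible solution of the linear programming dual of the assignment problem with permitted
pairs `R` and weights `w`. -/
def IsDualFeasible (R : X → X → Prop) (w : X → X → ℤ) (u v : X → ℤ) : Prop :=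
  ∀ x y, R x y → w x y ≤ u x + v y

theorem exists_isDualFeasible [Finite X] (R : X → X → Prop) (w : X → X → ℤ) :
    ∃ u v, IsDualFeasible R w u v := by
  cases nonempty_fintype X
  refine ⟨fun x => ∑ y, |w x y|, 0, fun x y _ => ?_⟩
  rw [Pi.zero_apply, add_zero]
  exact (le_abs_self _).trans
    (Finset.single_le_sum (f := fun z => |w x z|) (fun z _ => abs_nonneg _) (Finset.mem_univ y))

variable [Fintype X]

theorem IsDualFeasible.sum_diag_le (h : IsDualFeasible R w u v) (hR : ∀ x, R x x) :
    ∑ x, w x x ≤ ∑ x, (u x + v x) :=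
  Finset.sum_le_sum fun x _ => h x x (hR x)

/-- If the tight pairs violate Hall's condition at `s`, then lowering `u` on `s` and raising `v` on
the neighbours of `s` improves the dual solution. -/
theorem IsDualFeasible.exists_injective_or_sum_lt (h : IsDualFeasible R w u v) :
    (∃ f : X → X, f.Injective ∧ ∀ x, R x (f x) ∧ w x (f x) = u x + v (f x)) ∨
      ∃ u' v', IsDualFeasible R w u' v' ∧ ∑ x, (u' x + v' x) < ∑ x, (u x + v x) := by
  classical
  let t : X → Finset X := fun x => Finset.univ.filter fun y => R x y ∧ w x y = u x + v y
  by_cases hHall : ∀ s : Finset X, s.card ≤ (s.biUnion t).card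
  · obtain ⟨f, hf, hft⟩ := (Finset.all_card_le_biUnion_card_iff_exists_injective t).1 hHall
    exact Or.inl ⟨f, hf, fun x => by simpa [t] using hft x⟩
  push Not at hHall
  obtain ⟨s, hs⟩ := hHall
  refine Or.inr ⟨fun x => u x - if x ∈ s then 1 else 0,
    fun x => v x + if x ∈ s.biUnion t then 1 else 0, fun x y hxy => ?_, ?_⟩
  · have hle := h x y hxy
    have htight : x ∈ s → w x y = u x + v y → y ∈ s.biUnion t := fun hx he =>
      Finset.mem_biUnion.2 ⟨x, hx, by simp [t, hxy, he]⟩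
    dsimp only
    split_ifs with hx hy hy
    · omega
    · have : w x y ≠ u x + v y := fun he => hy (htight hx he)
      omega
    · omega
    · omega
  · simp only [Finset.sum_add_distrib, Finset.sum_sub_distrib, Finset.sum_boole,
      Finset.filter_univ_mem]
    omega

theorem exists_perm_and_tight_dual (hR : ∀ x, R x x) (w : X → X → ℤ) :
    ∃ (τ : Equiv.Perm X) (u v : X → ℤ), IsDualFeasible R w u v ∧ (∀ x, R x (τ x)) ∧
      ∑ x, w x (τ x) = ∑ x, (u x + v x) := by
  obtain ⟨d, ⟨u, v, huv, rfl⟩, hmin⟩ := Int.exists_least_of_bdd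
    (P := fun d => ∃ u v, IsDualFeasible R w u v ∧ ∑ x, (u x + v x) = d)
    ⟨∑ x, w x x, fun d ⟨u, v, huv, hd⟩ => hd ▸ huv.sum_diag_le hR⟩
    (let ⟨u, v, huv⟩ := exists_isDualFeasible R w; ⟨_, u, v, huv, rfl⟩)
  obtain ⟨f, hf, htight⟩ := huv.exists_injective_or_sum_lt.resolve_right
    fun ⟨u', v', huv', hlt⟩ => hlt.not_ge (hmin _ ⟨u', v', huv', rfl⟩)
  let τ := Equiv.ofBijective f hf.bijective_of_finite
  refine ⟨τ, u, v, huv, fun x => (htight x).1, ?_⟩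
  calc ∑ x, w x (τ x) = ∑ x, (u x + v (τ x)) := Finset.sum_congr rfl fun x _ => (htight x).2
    _ = ∑ x, (u x + v x) := by simp only [Finset.sum_add_distrib, Equiv.sum_comp τ v]

end Assignment

section PathNetwork

variable {α ι : Type*} [PartialOrder α] {k : ℕ}

/-- The permitted pairs of the assignment problem that encodes families of chains: an element of
`α` is sent to itself, to its successor in a chain, or, at the top of a chain, to an index in `ι`;
an index is sent to the bottom of a chain, or to an index if it is not used. -/
def PathAdj : α ⊕ ι → α ⊕ ι → Prop
  | Sum.inl p, Sum.inl q => p ≤ q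
  | _, _ => True

open Classical in
/-- The weight that rewards each element covered by a chain with `1` and charges each chain `k`. -/
noncomputable def pathWeight (k : ℕ) : α ⊕ ι → α ⊕ ι → ℤ
  | Sum.inl p, Sum.inl q => if p = q then 0 else 1
  | Sum.inl _, Sum.inr _ => 1
  | Sum.inr _, Sum.inl _ => -k
  | Sum.inr _, Sum.inr _ => 0

theorem pathAdj_refl (x : α ⊕ ι) : PathAdj x x := by
  cases x with
  | inl p => exact le_refl p
  | inr i => trivial

theorem PathAdj.le_of_apply_eq {τ : α ⊕ ι → α ⊕ ι} (hτ : ∀ x, PathAdj x (τ x)) {p q : α}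
    (h : τ (Sum.inl p) = Sum.inl q) : p ≤ q := by
  have hadj := hτ (Sum.inl p)
  rwa [h] at hadj

theorem exists_source_of_moved [WellFoundedLT α] {τ : Equiv.Perm (α ⊕ ι)}
    (hτ : ∀ x, PathAdj x (τ x)) {p : α} (hp : τ (Sum.inl p) ≠ Sum.inl p) :
    ∃ i s, τ (Sum.inr i) = Sum.inl s ∧
      Relation.ReflTransGen (fun p q => τ (Sum.inl p) = Sum.inl q) s p := by
  induction p using WellFoundedLT.induction with
  | ind p ih =>
    obtain ⟨q | i, hy⟩ := τ.surjective (Sum.inl p)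
    · have hqp : q ≠ p := by
        rintro rfl
        exact hp hy
      obtain ⟨i, s, hs, hsq⟩ := ih q ((PathAdj.le_of_apply_eq hτ hy).lt_of_ne hqp)
        fun h => hqp (Sum.inl_injective (h.symm.trans hy))
      exact ⟨i, s, hs, hsq.tail hy⟩
    · exact ⟨i, p, hy, Relation.ReflTransGen.refl⟩

variable [Fintype α]

open Classical in
theorem card_moved_le_chainNum [Fintype ι] {τ : Equiv.Perm (α ⊕ ι)}
    (hτ : ∀ x, PathAdj x (τ x)) :
    (Finset.univ.filter fun p : α => τ (Sum.inl p) ≠ Sum.inl p).card ≤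
      chainNum (Finset.univ : Finset α)
        (Finset.univ.filter fun i : ι => ∃ p, τ (Sum.inr i) = Sum.inl p).card := by
  let step : α → α → Prop := fun p q => τ (Sum.inl p) = Sum.inl q
  have hunique : Relator.RightUnique step := fun _ _ _ h h' =>
    Sum.inl_injective (h.symm.trans h')
  have hle : ∀ p q, Relation.ReflTransGen step p q → p ≤ q := by
    intro p q h
    induction h with
    | refl => exact le_rfl
    | tail _ h ih => exact ih.trans (PathAdj.le_of_apply_eq hτ h)
  have hsource := fun p : Finset.univ.filter fun p : α => τ (Sum.inl p) ≠ Sum.inl p =>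
    exists_source_of_moved hτ (Finset.mem_filter.1 p.2).2
  choose i s hi hs using hsource
  rw [chainNum_eq_colorNum]
  refine card_le_colorNum_card (Finset.subset_univ _) _ i
    (fun p => Finset.mem_filter.2 ⟨Finset.mem_univ _, s p, hi p⟩) fun p q hpq he => ?_
  have hss : s p = s q := Sum.inl_injective ((hi p).symm.trans (he ▸ hi q))
  rcases Relation.ReflTransGen.total_of_right_unique hunique (hs p) (hss ▸ hs q) with h | h
  exacts [hpq.1 (hle _ _ h), hpq.2 (hle _ _ h)]

theorem exists_sum_pathWeight_le [Fintype ι] {τ : Equiv.Perm (α ⊕ ι)}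
    (hτ : ∀ x, PathAdj x (τ x)) (k : ℕ) :
    ∃ h ≤ Fintype.card ι,
      ∑ x, pathWeight k x (τ x) + k * h ≤ (chainNum (Finset.univ : Finset α) h : ℤ) := by
  classical
  refine ⟨_, Finset.card_le_univ _, le_trans (le_of_eq ?_)
    (Nat.cast_le.2 (card_moved_le_chainNum hτ))⟩
  have hinl : ∀ p, pathWeight k (Sum.inl p) (τ (Sum.inl p)) =
      if τ (Sum.inl p) ≠ Sum.inl p then 1 else 0 := fun p => by
    rcases τ (Sum.inl p) with q | j <;> simp [pathWeight, eq_comm]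
  have hinr : ∀ i, pathWeight k (Sum.inr i) (τ (Sum.inr i)) =
      -k * if ∃ p, τ (Sum.inr i) = Sum.inl p then 1 else 0 := fun i => by
    rcases τ (Sum.inr i) with q | j <;> simp [pathWeight]
  simp only [Fintype.sum_sum_type, hinl, hinr, ← Finset.mul_sum, Finset.sum_boole]
  ring

theorem card_zero_le_antichainNum {u v : α ⊕ ι → ℤ}
    (huv : IsDualFeasible PathAdj (pathWeight k) u v) {i j : ι} {K : ℕ}
    (hK : u (Sum.inr i) + v (Sum.inr j) = K) :
    (Finset.univ.filter fun p : α => u (Sum.inl p) + v (Sum.inl p) = 0).card ≤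
      antichainNum (Finset.univ : Finset α) (k + K) := by
  have hnonneg : ∀ p, -(k : ℤ) ≤ u (Sum.inr i) + v (Sum.inl p) := fun p => huv _ _ trivial
  have hzero : ∀ p ∈ Finset.univ.filter fun p : α => u (Sum.inl p) + v (Sum.inl p) = 0,
      u (Sum.inl p) + v (Sum.inl p) = 0 := fun p hp => (Finset.mem_filter.1 hp).2
  rw [antichainNum_eq_colorNum]
  refine IsColoring.card_le_colorNum (f := fun p => (v (Sum.inl p) + k + u (Sum.inr i)).toNat)
    ⟨fun p hp => ?_, fun p hp q _ hpq => ?_⟩ (Finset.subset_univ _)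
  · have htop : 1 ≤ u (Sum.inl p) + v (Sum.inr j) := huv _ _ trivial
    have := hzero p hp
    have := hnonneg p
    omega
  · have hstep : 1 ≤ u (Sum.inl p) + v (Sum.inl q) := by
      simpa [pathWeight, hpq.ne] using huv (Sum.inl p) (Sum.inl q) hpq.le
    have := hzero p hp
    have := hnonneg p
    have := hnonneg q
    omega

theorem exists_le_sum_dual [Fintype ι] [Nonempty ι] {u v : α ⊕ ι → ℤ}
    (huv : IsDualFeasible PathAdj (pathWeight k) u v) :
    ∃ K : ℕ, (Fintype.card α + Fintype.card ι * K : ℤ) ≤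
      ∑ x, (u x + v x) + antichainNum (Finset.univ : Finset α) (k + K) := by
  obtain ⟨i, hi⟩ := Finite.exists_min fun i : ι => u (Sum.inr i)
  obtain ⟨j, hj⟩ := Finite.exists_min fun j : ι => v (Sum.inr j)
  obtain ⟨K, hK⟩ := Int.eq_ofNat_of_zero_le
    (show 0 ≤ u (Sum.inr i) + v (Sum.inr j) from huv _ _ trivial)
  have hzero : ((Finset.univ.filter fun p : α => u (Sum.inl p) + v (Sum.inl p) = 0).card : ℤ) ≤
      antichainNum (Finset.univ : Finset α) (k + K) :=
    Nat.cast_le.2 (card_zero_le_antichainNum huv hK)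
  have hinl : (Fintype.card α : ℤ) ≤ ∑ p : α, (u (Sum.inl p) + v (Sum.inl p)) +
      (Finset.univ.filter fun p : α => u (Sum.inl p) + v (Sum.inl p) = 0).card := by
    rw [Finset.card_filter, Nat.cast_sum, ← Finset.sum_add_distrib, ← Finset.card_univ,
      Finset.card_eq_sum_ones, Nat.cast_sum]
    refine Finset.sum_le_sum fun p _ => ?_
    have : 0 ≤ u (Sum.inl p) + v (Sum.inl p) := by
      simpa [pathWeight] using huv (Sum.inl p) (Sum.inl p) le_rfl
    split_ifs <;> push_cast <;> omega
  have hinr : (Fintype.card ι * K : ℤ) ≤ ∑ i : ι, (u (Sum.inr i) + v (Sum.inr i)) := by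
    rw [← nsmul_eq_mul, ← Finset.card_univ]
    exact Finset.card_nsmul_le_sum _ _ _ fun i' _ => hK ▸ add_le_add (hi i') (hj i')
  refine ⟨K, ?_⟩
  rw [Fintype.sum_sum_type]
  linarith

end PathNetwork

section Duality

variable {α : Type*} [PartialOrder α]

theorem chainNum_univ_coe (P : Finset α) (k : ℕ) :
    chainNum (Finset.univ : Finset P) k = chainNum P k := by
  rw [← chainNum_map (OrderEmbedding.subtype (· ∈ P))]
  exact congrArg (chainNum · k) P.attach_map_val

theorem antichainNum_univ_coe (P : Finset α) (k : ℕ) :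
    antichainNum (Finset.univ : Finset P) k = antichainNum P k := by
  rw [← antichainNum_map (OrderEmbedding.subtype (· ∈ P))]
  exact congrArg (antichainNum · k) P.attach_map_val

theorem exists_le_chainNum_add_antichainNum (P : Finset α) {N : ℕ} (hN : 0 < N) (k : ℕ) :
    ∃ h ≤ N, ∃ K, P.card + N * K + k * h ≤ chainNum P h + antichainNum P (k + K) := by
  have : Nonempty (Fin N) := ⟨⟨0, hN⟩⟩
  obtain ⟨τ, u, v, huv, hτ, hsum⟩ :=
    exists_perm_and_tight_dual pathAdj_refl (pathWeight k : P ⊕ Fin N → P ⊕ Fin N → ℤ)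
  obtain ⟨h, hh, hchain⟩ := exists_sum_pathWeight_le hτ k
  obtain ⟨K, hantichain⟩ := exists_le_sum_dual huv
  rw [Fintype.card_fin] at hh hantichain
  rw [Fintype.card_coe, antichainNum_univ_coe] at hantichain
  rw [chainNum_univ_coe] at hchain
  refine ⟨h, hh, K, ?_⟩
  zify
  linarith

theorem chainNum_add_antichainNum_le (P : Finset α) (h k : ℕ) :
    chainNum P h + antichainNum P k ≤ P.card + h * k := by
  classical
  rw [chainNum_eq_colorNum, antichainNum_eq_colorNum]
  obtain ⟨S, hS, f, hf, hcS⟩ := exists_isColoring_card_eq (IncompRel (· ≤ ·)) P h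
  obtain ⟨T, hT, g, hg, hcT⟩ := exists_isColoring_card_eq (· < ·) P k
  have hinj : Set.InjOn (fun x => (f x, g x)) (S ∩ T : Finset α) := by
    intro x hx y hy hxy
    obtain ⟨hxS, hxT⟩ := Finset.mem_inter.1 hx
    obtain ⟨hyS, hyT⟩ := Finset.mem_inter.1 hy
    obtain ⟨hfxy, hgxy⟩ := Prod.mk.inj hxy
    by_contra hne
    exact hf.ne x hxS y hyS ⟨fun hle => hg.ne x hxT y hyT (hle.lt_of_ne hne) hgxy,
      fun hle => hg.ne y hyT x hxT (hle.lt_of_ne' hne) hgxy.symm⟩ hfxy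
  have hinter : (S ∩ T).card ≤ h * k := by
    rw [← Finset.card_range h, ← Finset.card_range k, ← Finset.card_product]
    refine Finset.card_le_card_of_injOn _ (fun x hx => ?_) hinj
    obtain ⟨hxS, hxT⟩ := Finset.mem_inter.1 hx
    simpa using ⟨hf.lt x hxS, hg.lt x hxT⟩
  rw [← hcS, ← hcT, ← Finset.card_union_add_card_inter]
  exact add_le_add (Finset.card_le_card (Finset.union_subset hS hT)) hinter

theorem exists_antichainNum_dual (P : Finset α) (h : ℕ) :
    ∃ k, chainNum P h + antichainNum P k = P.card + h * k := by
  rcases Nat.eq_zero_or_pos h with rfl | hpos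
  · exact ⟨P.card, by rw [chainNum_zero, antichainNum_eq_card le_rfl, zero_mul, add_comm]⟩
  obtain ⟨h', hle, k, hge⟩ := exists_le_chainNum_add_antichainNum P hpos 0
  refine ⟨k, le_antisymm (chainNum_add_antichainNum_le P h k) ?_⟩
  have := chainNum_mono P hle
  simp only [zero_mul, zero_add, add_zero] at hge
  omega

theorem exists_chainNum_dual (P : Finset α) (k : ℕ) :
    ∃ h, chainNum P h + antichainNum P k = P.card + h * k := by
  obtain ⟨h, -, K, hge⟩ := exists_le_chainNum_add_antichainNum P P.card.succ_pos k
  have hK : K = 0 := by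
    by_contra hK
    have := chainNum_le_card P h
    have := antichainNum_le_card P (k + K)
    have := Nat.le_mul_of_pos_right P.card.succ (Nat.pos_of_ne_zero hK)
    omega
  subst hK
  refine ⟨h, le_antisymm (chainNum_add_antichainNum_le P h k) ?_⟩
  rwa [mul_zero, add_zero, add_zero, mul_comm k h] at hge

end Duality

section Shape

variable {α : Type*} [PartialOrder α]

/-- The number of elements gained by allowing a `(k + 1)`-st chain; once Greene's duality theorem is
proved, this is the length of row `k` of the shape of `P`. -/
noncomputable def rowDiff (P : Finset α) (k : ℕ) : ℕ := chainNum P (k + 1) - chainNum P k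

theorem sum_rowDiff (P : Finset α) (k : ℕ) : ∑ i ∈ Finset.range k, rowDiff P i = chainNum P k := by
  simp only [rowDiff, Finset.sum_range_tsub (chainNum_mono P), chainNum_zero, Nat.sub_zero]

theorem rowDiff_eq_zero {P : Finset α} {k : ℕ} (hk : P.card ≤ k) : rowDiff P k = 0 := by
  rw [rowDiff, chainNum_eq_card hk, chainNum_eq_card (hk.trans k.le_succ), Nat.sub_self]

/-- A bound `c_h + a_l ≤ |P| + h l` that is tight at `h = k + 1` makes `c` concave there. -/
theorem rowDiff_antitone (P : Finset α) : Antitone (rowDiff P) := by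
  refine antitone_nat_of_succ_le fun k => ?_
  obtain ⟨l, hl⟩ := exists_antichainNum_dual P (k + 1)
  have hk := chainNum_add_antichainNum_le P k l
  have hk2 := chainNum_add_antichainNum_le P (k + 1 + 1) l
  have hmono := chainNum_mono P (Nat.le_add_right k 1)
  simp only [rowDiff, add_mul, one_mul] at *
  omega

theorem sum_range_add_mul_le {d : ℕ → ℕ} {k l : ℕ} (hge : ∀ i ≥ k, d i ≤ l)
    (hlt : ∀ i < k, l ≤ d i) (h : ℕ) :
    ∑ i ∈ Finset.range h, d i + k * l ≤ ∑ i ∈ Finset.range k, d i + h * l := by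
  rcases le_total k h with hkh | hhk
  · obtain ⟨m, rfl⟩ := Nat.exists_eq_add_of_le hkh
    have hle : ∑ i ∈ Finset.range m, d (k + i) ≤ m * l := by
      simpa using Finset.sum_le_card_nsmul (Finset.range m) (fun i => d (k + i)) l
        fun i _ => hge _ (Nat.le_add_right k i)
    rw [Finset.sum_range_add, add_mul]
    omega
  · obtain ⟨m, rfl⟩ := Nat.exists_eq_add_of_le hhk
    have hle : m * l ≤ ∑ i ∈ Finset.range m, d (h + i) := by
      simpa using Finset.card_nsmul_le_sum (Finset.range m) (fun i => d (h + i)) l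
        fun i hi => hlt _ (Nat.add_lt_add_left (Finset.mem_range.1 hi) h)
    rw [Finset.sum_range_add, add_mul]
    omega

/-- Weak duality is tight at the outer corners of the shape. -/
theorem chainNum_add_antichainNum_eq {P : Finset α} {k l : ℕ} (hk : rowDiff P k ≤ l)
    (hl : ∀ i < k, l ≤ rowDiff P i) :
    chainNum P k + antichainNum P l = P.card + k * l := by
  refine le_antisymm (chainNum_add_antichainNum_le P k l) ?_
  obtain ⟨h, hh⟩ := exists_chainNum_dual P l
  have := sum_range_add_mul_le (fun i hi => (rowDiff_antitone P hi).trans hk) hl h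
  rw [sum_rowDiff, sum_rowDiff] at this
  omega

theorem exists_youngDiagram_rowLen_eq {d : ℕ → ℕ} (hd : Antitone d) {n : ℕ} (hn : d n = 0) :
    ∃ μ : YoungDiagram, ∀ k, μ.rowLen k = d k := by
  let μ : YoungDiagram :=
    { cells := (Finset.range n ×ˢ Finset.range (d 0)).filter fun x => x.2 < d x.1
      isLowerSet := by
        rintro ⟨i, j⟩ ⟨i', j'⟩ ⟨hi, hj⟩ h
        simp only [Finset.coe_filter, Finset.mem_product, Finset.mem_range,
          Set.mem_ofPred_eq] at hi hj h ⊢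
        have := hd hi
        omega }
  refine ⟨μ, fun k => eq_of_forall_lt_iff fun j => ?_⟩
  rw [← YoungDiagram.mem_iff_lt_rowLen, ← YoungDiagram.mem_cells]
  simp only [μ, Finset.mem_filter, Finset.mem_product, Finset.mem_range, and_iff_right_iff_imp]
  intro hj
  refine ⟨?_, hj.trans_le (hd k.zero_le)⟩
  by_contra! hk
  have := hd hk
  omega

theorem exists_isShape (P : Finset α) : ∃ μ : YoungDiagram, IsShape P μ := by
  obtain ⟨μ, hμ⟩ := exists_youngDiagram_rowLen_eq (rowDiff_antitone P) (rowDiff_eq_zero le_rfl)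
  refine ⟨μ, hμ, fun k => ?_⟩
  have hcol : ∀ i, i < μ.colLen k ↔ k < rowDiff P i := fun i => by
    rw [← YoungDiagram.mem_iff_lt_colLen, YoungDiagram.mem_iff_lt_rowLen, hμ]
  have hcorner : rowDiff P (μ.colLen k) ≤ k := not_lt.1 fun h => lt_irrefl _ ((hcol _).2 h)
  have hk := chainNum_add_antichainNum_eq hcorner fun i hi => ((hcol i).1 hi).le
  have hk1 := chainNum_add_antichainNum_eq (hcorner.trans k.le_succ) fun i hi => (hcol i).1 hi
  rw [Nat.succ_eq_add_one, mul_add, mul_one] at hk1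
  omega

theorem isShape_shape (P : Finset α) : IsShape P (shape P) := by
  have h := exists_isShape P
  rw [shape, dif_pos h]
  exact h.choose_spec

theorem chainNum_eq_sum_rowLen (P : Finset α) (k : ℕ) :
    chainNum P k = ∑ i ∈ Finset.range k, (shape P).rowLen i := by
  simp only [(isShape_shape P).1, Finset.sum_range_tsub (chainNum_mono P), chainNum_zero,
    Nat.sub_zero]

theorem antichainNum_eq_sum_colLen (P : Finset α) (k : ℕ) :
    antichainNum P k = ∑ j ∈ Finset.range k, (shape P).colLen j := by
  simp only [(isShape_shape P).2, Finset.sum_range_tsub (antichainNum_mono P), antichainNum_zero,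
    Nat.sub_zero]

end Shape

section AddsBox

variable {μ μ₁ μ₂ ρ : YoungDiagram} {a b c d : ℕ × ℕ}

theorem ext_rowLen (h : ∀ k, μ₁.rowLen k = μ₂.rowLen k) : μ₁ = μ₂ := by
  ext ⟨i, j⟩
  simp only [YoungDiagram.mem_cells, YoungDiagram.mem_iff_lt_rowLen, h]

theorem AddsBox.mem_iff (h : AddsBox μ b ρ) {x : ℕ × ℕ} : x ∈ ρ ↔ x = b ∨ x ∈ μ := by
  rw [← YoungDiagram.mem_cells, h.2, Finset.mem_insert, YoungDiagram.mem_cells]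

theorem AddsBox.ne (h : AddsBox μ b ρ) : ρ ≠ μ := by
  rintro rfl
  exact h.1 (h.mem_iff.2 (Or.inl rfl))

theorem AddsBox.le (h : AddsBox μ b ρ) : μ ≤ ρ := fun _ hx => h.mem_iff.2 (Or.inr hx)

theorem AddsBox.box_unique (h : AddsBox μ a ρ) (h' : AddsBox μ b ρ) : a = b :=
  (h'.mem_iff.1 (h.mem_iff.2 (Or.inl rfl))).resolve_right h.1

theorem AddsBox.transpose (h : AddsBox μ b ρ) : AddsBox μ.transpose b.swap ρ.transpose := by
  refine ⟨by simpa using h.1, ?_⟩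
  ext x
  simp only [YoungDiagram.mem_cells, YoungDiagram.mem_transpose, h.mem_iff, Finset.mem_insert,
    Prod.swap_eq_iff_eq_swap]

theorem addsBox_of_rowLen {r : ℕ} (h : ∀ k, ρ.rowLen k = μ.rowLen k + if k = r then 1 else 0) :
    AddsBox μ (r, μ.rowLen r) ρ := by
  refine ⟨fun hm => lt_irrefl _ (YoungDiagram.mem_iff_lt_rowLen.1 hm), ?_⟩
  ext ⟨i, j⟩
  simp only [Finset.mem_insert, YoungDiagram.mem_cells, YoungDiagram.mem_iff_lt_rowLen, h,
    Prod.mk.injEq]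
  split_ifs with hi
  · subst hi
    omega
  · omega

theorem AddsBox.rowLen_eq (h : AddsBox μ b ρ) (k : ℕ) :
    ρ.rowLen k = μ.rowLen k + if k = b.1 then 1 else 0 := by
  have hrow : ρ.row k = if k = b.1 then insert b (μ.row k) else μ.row k := by
    rw [YoungDiagram.row, YoungDiagram.row, h.2, Finset.filter_insert]
    simp only [eq_comm]
  rw [YoungDiagram.rowLen_eq_card, YoungDiagram.rowLen_eq_card, hrow]
  split_ifs
  · exact Finset.card_insert_of_notMem fun hm => h.1 (YoungDiagram.mem_row_iff.1 hm).1
  · rfl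

theorem AddsBox.sum_rowLen_eq (h : AddsBox μ b ρ) (k : ℕ) :
    ∑ i ∈ Finset.range k, ρ.rowLen i =
      ∑ i ∈ Finset.range k, μ.rowLen i + if b.1 < k then 1 else 0 := by
  simp only [h.rowLen_eq, Finset.sum_add_distrib, Finset.sum_ite_eq', Finset.mem_range]

theorem AddsBox.sum_colLen_eq (h : AddsBox μ b ρ) (k : ℕ) :
    ∑ j ∈ Finset.range k, ρ.colLen j =
      ∑ j ∈ Finset.range k, μ.colLen j + if b.2 < k then 1 else 0 := by
  simpa using h.transpose.sum_rowLen_eq k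

theorem AddsBox.eq_of_row_eq (h : AddsBox μ a μ₁) (h' : AddsBox μ b μ₂) (hab : a.1 = b.1) :
    μ₁ = μ₂ :=
  ext_rowLen fun k => by rw [h.rowLen_eq, h'.rowLen_eq, hab]

theorem AddsBox.eq_sup (h₁ : AddsBox μ a μ₁) (h₂ : AddsBox μ b μ₂) (hne : μ₁ ≠ μ₂)
    (hc : AddsBox μ₁ c ρ) (hd : AddsBox μ₂ d ρ) : ρ = μ₁ ⊔ μ₂ := by
  have hab : a ≠ b := fun hab => hne (h₁.eq_of_row_eq h₂ (congrArg Prod.fst hab))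
  have hb : b ∈ ρ := hd.le (h₂.mem_iff.2 (Or.inl rfl))
  have hcb : b = c := (hc.mem_iff.1 hb).resolve_right fun hb1 =>
    (h₁.mem_iff.1 hb1).elim hab.symm h₂.1
  ext x
  simp only [YoungDiagram.mem_cells, YoungDiagram.mem_sup, hc.mem_iff, h₂.mem_iff, h₁.mem_iff, hcb]
  tauto

theorem AddsBox.row_lt_of_col_le (h : AddsBox μ c ρ) (ha : a ∈ μ) (hcol : c.2 ≤ a.2) :
    a.1 < c.1 := by
  by_contra! hrow
  exact h.1 (μ.up_left_mem hrow hcol ha)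

variable {α : Type*} [PartialOrder α] {P Q : Finset α}

theorem AddsBox.chainNum_eq (h : AddsBox (shape Q) b (shape P)) (k : ℕ) :
    chainNum P k = chainNum Q k + if b.1 < k then 1 else 0 := by
  rw [chainNum_eq_sum_rowLen, chainNum_eq_sum_rowLen, h.sum_rowLen_eq]

theorem AddsBox.antichainNum_eq (h : AddsBox (shape Q) b (shape P)) (k : ℕ) :
    antichainNum P k = antichainNum Q k + if b.2 < k then 1 else 0 := by
  rw [antichainNum_eq_sum_colLen, antichainNum_eq_sum_colLen, h.sum_colLen_eq]

/-- The increments `c_k(P) - c_k(Q)` form a sequence of zeros followed by a sequence of ones. -/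
theorem exists_addsBox_of_chainNum [DecidableEq α] {p : α} (hp : p ∉ Q)
    (hstep : ∀ k, chainNum (insert p Q) k + chainNum Q (k + 1) ≤
      chainNum (insert p Q) (k + 1) + chainNum Q k) :
    ∃ b, AddsBox (shape Q) b (shape (insert p Q)) := by
  have hle : ∀ k, chainNum Q k ≤ chainNum (insert p Q) k ∧
      chainNum (insert p Q) k ≤ chainNum Q k + 1 := fun k => by
    simp only [chainNum_eq_colorNum]
    exact ⟨colorNum_le_of_subset (Finset.subset_insert p Q), colorNum_insert_le p⟩
  have hex : ∃ k, chainNum Q (k + 1) < chainNum (insert p Q) (k + 1) := by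
    refine ⟨Q.card, ?_⟩
    rw [chainNum_eq_card Q.card.le_succ, chainNum_eq_card (Finset.card_insert_le p Q),
      Finset.card_insert_of_notMem hp]
    exact Nat.lt_succ_self _
  classical
  let r := Nat.find hex
  have hjump : ∀ k, chainNum (insert p Q) k = chainNum Q k + if r < k then 1 else 0 := by
    intro k
    have hr : chainNum Q (r + 1) < chainNum (insert p Q) (r + 1) := Nat.find_spec hex
    split_ifs with hk
    · induction k, hk using Nat.le_induction with
      | base => exact (hle (r + 1)).2.antisymm hr
      | succ k _ ih =>
        have := hle (k + 1)
        have := hstep k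
        omega
    · obtain _ | k := k
      · rw [chainNum_zero, chainNum_zero]
      · have := Nat.find_min hex (show k < r by omega)
        have := hle (k + 1)
        omega
  refine ⟨(r, (shape Q).rowLen r), addsBox_of_rowLen fun k => ?_⟩
  have := chainNum_mono Q (Nat.le_add_right k 1)
  rw [(isShape_shape _).1, (isShape_shape _).1, hjump, hjump]
  split_ifs <;> omega

end AddsBox

section Labeling

variable {α : Type*} {R : α → α → Prop} {P Q S A B : Finset α} {k l : ℕ} {f : α → ℕ}
  {lo hi lo' hi' : α → ℕ}

/-- A `k`-labelling of `P` for the relation `R`: each `x ∈ P` carries labels `lo x ≤ hi x` that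
agree or jump by one, and labels increase along `R`. The elements at which a labelling jumps are
properly coloured by `lo`. -/
structure IsLabeling (R : α → α → Prop) (P : Finset α) (k : ℕ) (lo hi : α → ℕ) : Prop where
  le : ∀ x ∈ P, lo x ≤ hi x
  le_add_one : ∀ x ∈ P, hi x ≤ lo x + 1
  le_top : ∀ x ∈ P, hi x ≤ k
  rel : ∀ x ∈ P, ∀ y ∈ P, R x y → hi x ≤ lo y

theorem IsLabeling.subset (h : IsLabeling R P k lo hi) (hQ : Q ⊆ P) : IsLabeling R Q k lo hi :=
  ⟨fun x hx => h.le x (hQ hx), fun x hx => h.le_add_one x (hQ hx), fun x hx => h.le_top x (hQ hx),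
    fun x hx y hy => h.rel x (hQ hx) y (hQ hy)⟩

theorem IsLabeling.sum_le_colorNum (h : IsLabeling R P k lo hi) :
    ∑ x ∈ P, (hi x - lo x) ≤ colorNum R P k := by
  have hcard : ∑ x ∈ P, (hi x - lo x) = (P.filter fun x => lo x < hi x).card := by
    rw [Finset.card_filter]
    refine Finset.sum_congr rfl fun x hx => ?_
    have := h.le_add_one x hx
    split_ifs <;> omega
  rw [hcard]
  refine IsColoring.card_le_colorNum (f := lo) ⟨fun x hx => ?_, fun x hx y hy hxy => ?_⟩
    (Finset.filter_subset _ _)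
  · obtain ⟨hx, hlt⟩ := Finset.mem_filter.1 hx
    exact hlt.trans_le (h.le_top x hx)
  · obtain ⟨hx, hlt⟩ := Finset.mem_filter.1 hx
    exact (hlt.trans_le (h.rel x hx y (Finset.mem_filter.1 hy).1 hxy)).ne

theorem IsLabeling.sup (h : IsLabeling R P k lo hi) (h' : IsLabeling R P l lo' hi') (hkl : k ≤ l) :
    IsLabeling R P l (lo ⊔ lo') (hi ⊔ hi') where
  le x hx := sup_le_sup (h.le x hx) (h'.le x hx)
  le_add_one x hx := by
    have := h.le_add_one x hx
    have := h'.le_add_one x hx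
    simp only [Pi.sup_apply]
    omega
  le_top x hx := sup_le ((h.le_top x hx).trans hkl) (h'.le_top x hx)
  rel x hx y hy hxy := sup_le_sup (h.rel x hx y hy hxy) (h'.rel x hx y hy hxy)

theorem IsLabeling.inf (h : IsLabeling R P k lo hi) (h' : IsLabeling R P l lo' hi') :
    IsLabeling R P k (lo ⊓ lo') (hi ⊓ hi') where
  le x hx := inf_le_inf (h.le x hx) (h'.le x hx)
  le_add_one x hx := by
    have := h.le_add_one x hx
    have := h'.le_add_one x hx
    simp only [Pi.inf_apply]
    omega
  le_top x hx := inf_le_left.trans (h.le_top x hx)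
  rel x hx y hy hxy := inf_le_inf (h.rel x hx y hy hxy) (h'.rel x hx y hy hxy)

/-- The supremum and the infimum of two labellings have together as many jumps as the two. -/
theorem IsLabeling.sum_add_sum_le (h : IsLabeling R P k lo hi) (h' : IsLabeling R P l lo' hi')
    (hkl : k ≤ l) (hQ : Q ⊆ P) (heq : ∀ x ∈ P, x ∉ Q → hi x ⊓ hi' x = lo x ⊓ lo' x) :
    ∑ x ∈ P, (hi x - lo x) + ∑ x ∈ P, (hi' x - lo' x) ≤ colorNum R P l + colorNum R Q k := by
  have hinf : ∑ x ∈ P, (hi x ⊓ hi' x - lo x ⊓ lo' x) ≤ colorNum R Q k := by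
    rw [← Finset.sum_subset hQ fun x hx hxQ => by rw [heq x hx hxQ, Nat.sub_self]]
    exact ((h.inf h').subset hQ).sum_le_colorNum
  refine le_trans (le_of_eq ?_) (add_le_add (h.sup h' hkl).sum_le_colorNum hinf)
  rw [← Finset.sum_add_distrib, ← Finset.sum_add_distrib]
  refine Finset.sum_congr rfl fun x hx => ?_
  have := h.le x hx
  have := h'.le x hx
  simp only [Pi.sup_apply]
  omega

/-- Nothing has to lie above the labels of `R`-maximal elements, so they can be moved to the top. -/
theorem IsLabeling.raise [DecidableEq α] (h : IsLabeling R P k lo hi) {M : Finset α}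
    (hM : ∀ x ∈ M, ∀ y ∈ P, ¬ R x y) :
    IsLabeling R P k (fun x => if x ∈ M then k - (hi x - lo x) else lo x)
      (fun x => if x ∈ M then k else hi x) where
  le x hx := by
    have := h.le x hx
    split_ifs <;> omega
  le_add_one x hx := by
    have := h.le_add_one x hx
    split_ifs <;> omega
  le_top x hx := by
    have := h.le_top x hx
    split_ifs <;> omega
  rel x hx y hy hxy := by
    have := h.rel x hx y hy hxy
    have := h.le y hy
    have := h.le_top y hy
    rw [if_neg fun hxM => hM x hxM y hy hxy]
    split_ifs <;> omega

theorem chainHeight_add_one_le {s : Set α} (hs : s.Finite) {x : α} (hx : x ∉ s)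
    (hR : ∀ y ∈ s, R y x) : s.chainHeight R + 1 ≤ (insert x s).chainHeight R := by
  obtain ⟨t, hts, hcard, ht⟩ := Set.exists_eq_chainHeight_of_finite _ R hs
  rw [← hcard, ← Set.encard_insert_of_notMem fun h => hx (hts h)]
  exact Set.encard_le_chainHeight_of_isChain _ _ (Set.insert_subset_insert hts)
    (ht.insert fun y hy _ => Or.inr (hR y (hts hy)))

theorem IsColoring.chainHeight_le (hf : IsColoring R S k f) :
    (S : Set α).chainHeight R ≤ k := by
  obtain ⟨t, hts, hcard, ht⟩ := Set.exists_eq_chainHeight_of_finite _ R S.finite_toSet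
  have hinj : Set.InjOn f t := fun x hx y hy hxy => by
    by_contra hne
    rcases ht hx hy hne with h | h
    exacts [hf.ne x (hts hx) y (hts hy) h hxy, hf.ne y (hts hy) x (hts hx) h hxy.symm]
  rw [← hcard, ← hinj.encard_image, ← Finset.card_range k, ← Set.encard_coe_eq_coe_finsetCard]
  refine Set.encard_le_encard ?_
  rintro _ ⟨x, hx, rfl⟩
  exact Finset.mem_coe.2 (Finset.mem_range.2 (hf.lt x (hts hx)))

open Classical in
/-- The labels are the heights of the elements relative to the coloured set. -/
theorem IsColoring.exists_isLabeling [IsStrictOrder α R] (hf : IsColoring R S k f)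
    (P : Finset α) : ∃ lo, IsLabeling R P k lo (fun x => lo x + if x ∈ S then 1 else 0) ∧
      ∀ x, (∀ y ∈ S, ¬ R y x) → lo x = 0 := by
  let below : α → Set α := fun x => {y | y ∈ S ∧ R y x}
  have hfin : ∀ x, (below x).Finite := fun x => S.finite_toSet.subset fun _ hy => hy.1
  have hcoe : ∀ x, ((below x).chainHeight R).toNat = (below x).chainHeight R := fun x =>
    ENat.natCast_toNat (Set.chainHeight_ne_top_of_finite _ R (hfin x))
  have key : ∀ (x : α) (t : Set α), below x ⊆ t → (x ∈ S → x ∈ t) →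
      ((((below x).chainHeight R).toNat + if x ∈ S then 1 else 0 : ℕ) : ℕ∞) ≤ t.chainHeight R := by
    intro x t ht hxt
    push_cast
    rw [hcoe]
    split_ifs with hx
    · exact (chainHeight_add_one_le (hfin x) (fun h => irrefl_of R x h.2) fun _ hy => hy.2).trans
        (Set.chainHeight_mono _ _ _ (Set.insert_subset (hxt hx) ht))
    · simpa using Set.chainHeight_mono _ _ _ ht
  refine ⟨fun x => ((below x).chainHeight R).toNat,
    ⟨fun x _ => Nat.le_add_right _ _, fun x _ => ?_, fun x _ => ?_, fun x _ y _ hxy => ?_⟩,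
    fun x hx => ?_⟩
  · dsimp only
    split_ifs <;> omega
  · exact_mod_cast (key x S (fun _ hy => hy.1) id).trans hf.chainHeight_le
  · rw [← Nat.cast_le (α := ℕ∞), hcoe y]
    exact key x _ (fun z hz => ⟨hz.1, trans_of R hz.2 hxy⟩) fun hx => ⟨hx, hxy⟩
  · have hempty : below x = ∅ := Set.eq_empty_of_forall_notMem fun y hy => hx y hy.1 hy.2
    simp only [hempty, Set.chainHeight_empty, ENat.toNat_zero]

theorem exists_isLabeling_sum_eq (R : α → α → Prop) [IsStrictOrder α R] (hQ : Q ⊆ P) (k : ℕ) :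
    ∃ lo hi, IsLabeling R P k lo hi ∧ ∑ x ∈ P, (hi x - lo x) = colorNum R Q k ∧
      (∀ x ∉ Q, hi x = lo x) ∧ ∀ x, (∀ y ∈ P, ¬ R y x) → lo x = 0 := by
  classical
  obtain ⟨S, hS, f, hf, hcard⟩ := exists_isColoring_card_eq R Q k
  obtain ⟨lo, h, hzero⟩ := hf.exists_isLabeling P
  refine ⟨lo, _, h, ?_, fun x hx => ?_, fun x hx => hzero x fun y hy => hx y (hQ (hS hy))⟩
  · simp only [Nat.add_sub_cancel_left, Finset.sum_boole, Finset.filter_mem_eq_inter,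
      Finset.inter_eq_right.2 (hS.trans hQ), hcard, Nat.cast_id]
  · simp only [if_neg fun h => hx (hS h), add_zero]

/-- Raise the `R`-maximal elements of `B \ A` in an optimal labelling for `B` and compare it with an
optimal labelling for `A`: their minimum does not jump outside `A ∩ B`. -/
theorem colorNum_add_colorNum_le [IsStrictOrder α R] [DecidableEq α] (hkl : k ≤ l)
    (hA : ∀ x ∈ A \ B, ∀ y ∈ A ∪ B, ¬ R y x)
    (hB : ∀ x ∈ B \ A, (∀ y ∈ A ∪ B, ¬ R y x) ∨ k < l ∧ ∀ y ∈ A ∪ B, ¬ R x y) :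
    colorNum R A k + colorNum R B l ≤ colorNum R (A ∪ B) l + colorNum R (A ∩ B) k := by
  classical
  obtain ⟨lo, hi, h, hsum, hjump, hzero⟩ := exists_isLabeling_sum_eq R Finset.subset_union_left k
  obtain ⟨lo', hi', h', hsum', hjump', hzero'⟩ :=
    exists_isLabeling_sum_eq R Finset.subset_union_right l
  let M := (B \ A).filter fun x => ∀ y ∈ A ∪ B, ¬ R x y
  have hraise := h'.raise fun x (hx : x ∈ M) => (Finset.mem_filter.1 hx).2
  have hsumM : ∑ x ∈ A ∪ B, (hi' x - lo' x) = ∑ x ∈ A ∪ B,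
      ((if x ∈ M then l else hi' x) - if x ∈ M then l - (hi' x - lo' x) else lo' x) := by
    refine Finset.sum_congr rfl fun x hx => ?_
    have := h'.le_top x hx
    split_ifs <;> omega
  rw [← hsum, ← hsum', hsumM]
  refine h.sum_add_sum_le hraise hkl
    (Finset.inter_subset_left.trans Finset.subset_union_left) fun x hx hxAB => ?_
  by_cases hxA : x ∈ A
  · have hxB : x ∉ B := fun hxB => hxAB (Finset.mem_inter.2 ⟨hxA, hxB⟩)
    have hmin := hA x (Finset.mem_sdiff.2 ⟨hxA, hxB⟩)
    have hxM : x ∉ M := fun h => (Finset.mem_sdiff.1 (Finset.mem_filter.1 h).1).2 hxA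
    simp only [if_neg hxM, hjump' x hxB, hzero x hmin, hzero' x hmin]
    omega
  have hxBA : x ∈ B \ A := Finset.mem_sdiff.2 ⟨(Finset.mem_union.1 hx).resolve_left hxA, hxA⟩
  rw [hjump x hxA]
  rcases hB x hxBA with hmin | ⟨hlt, hmax⟩
  · rw [hzero x hmin, Nat.zero_min, Nat.zero_min]
  · have hxM : x ∈ M := Finset.mem_filter.2 ⟨hxBA, hmax⟩
    have := h.le_top x hx
    have := hjump x hxA
    have := h'.le_add_one x hx
    simp only [if_pos hxM]
    omega

theorem colorNum_insert_add_colorNum_le [IsStrictOrder α R] [DecidableEq α] {p : α} (hp : p ∉ Q)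
    (hmin : ∀ x ∈ Q, ¬ R x p) (hkl : k ≤ l) :
    colorNum R (insert p Q) k + colorNum R Q l ≤ colorNum R (insert p Q) l + colorNum R Q k := by
  have hsub := Finset.subset_insert p Q
  have h := colorNum_add_colorNum_le (R := R) (A := insert p Q) (B := Q) hkl ?_
    (by simp [Finset.sdiff_eq_empty_iff_subset.2 hsub])
  · rwa [Finset.union_eq_left.2 hsub, Finset.inter_eq_right.2 hsub] at h
  · rw [Finset.insert_sdiff_cancel hp, Finset.union_eq_left.2 hsub]
    simp only [Finset.mem_singleton, forall_eq, Finset.forall_mem_insert]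
    exact ⟨irrefl_of R p, hmin⟩

theorem colorNum_insert_add_colorNum_insert_le [IsStrictOrder α R] [DecidableEq α] {p q : α}
    (hp : p ∉ Q) (hq : q ∉ Q) (hpq : p ≠ q) (hkl : k ≤ l) (hmin : ∀ x ∈ insert q Q, ¬ R x p)
    (hext : (∀ x ∈ insert p Q, ¬ R x q) ∨ k < l ∧ ∀ x ∈ insert p Q, ¬ R q x) :
    colorNum R (insert p Q) k + colorNum R (insert q Q) l ≤
      colorNum R (insert p (insert q Q)) l + colorNum R Q k := by
  have hunion : insert p Q ∪ insert q Q = insert p (insert q Q) := by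
    rw [Finset.insert_union, Finset.union_insert, Finset.union_idempotent]
  have hinter : insert p Q ∩ insert q Q = Q := by
    rw [Finset.insert_inter_of_notMem (by simp [hp, hpq]),
      Finset.inter_eq_left.2 (Finset.subset_insert q Q)]
  have hp' : insert p Q \ insert q Q = {p} := by
    rw [Finset.insert_sdiff_of_notMem _ (by simp [hp, hpq]),
      Finset.sdiff_eq_empty_iff_subset.2 (Finset.subset_insert q Q), insert_empty_eq]
  have hq' : insert q Q \ insert p Q = {q} := by
    rw [Finset.insert_sdiff_of_notMem _ (by simp [hq, hpq.symm]),
      Finset.sdiff_eq_empty_iff_subset.2 (Finset.subset_insert p Q), insert_empty_eq]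
  have hpp := irrefl_of R p
  have hqq := irrefl_of R q
  have h := colorNum_add_colorNum_le (R := R) (A := insert p Q) (B := insert q Q) hkl ?_ ?_
  · rwa [hunion, hinter] at h
  · simp only [hp', hunion, Finset.mem_singleton, Finset.mem_insert] at hmin ⊢
    grind
  · simp only [hq', hunion, Finset.mem_singleton, Finset.mem_insert] at hext ⊢
    grind

end Labeling

section LocalRule

/-- The four growth rules, as a relation between the corners of a unit square: `lam` is the
southwest corner, `nu` and `mu` are the southeast and northwest corners, `rho` is the northeast
corner, and `w` says that the square is marked. -/
def LocalRule (lam nu mu : YoungDiagram) (w : Prop) (rho : YoungDiagram) : Prop :=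
  (nu ≠ mu → rho = nu ⊔ mu) ∧
  (nu = mu → mu = lam → ¬ w → rho = lam) ∧
  (nu = mu → mu = lam → w → ∃ B : ℕ × ℕ, B.1 = 0 ∧ AddsBox lam B rho) ∧
  (nu = mu → mu ≠ lam → ∃ A B : ℕ × ℕ, AddsBox lam A mu ∧ B.1 = A.1 + 1 ∧ AddsBox mu B rho)

variable {lam nu mu rho rho' : YoungDiagram} {w : Prop} {b : ℕ × ℕ}

theorem LocalRule.unique (h : LocalRule lam nu mu w rho) (h' : LocalRule lam nu mu w rho') :
    rho = rho' := by
  by_cases hnu : nu = mu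
  · by_cases hmu : mu = lam
    · by_cases hw : w
      · obtain ⟨B, hB, hb⟩ := h.2.2.1 hnu hmu hw
        obtain ⟨B', hB', hb'⟩ := h'.2.2.1 hnu hmu hw
        exact hb.eq_of_row_eq hb' (hB.trans hB'.symm)
      · rw [h.2.1 hnu hmu hw, h'.2.1 hnu hmu hw]
    · obtain ⟨A, B, hA, hAB, hB⟩ := h.2.2.2 hnu hmu
      obtain ⟨A', B', hA', hAB', hB'⟩ := h'.2.2.2 hnu hmu
      exact hB.eq_of_row_eq hB' (by rw [hAB, hAB', hA.box_unique hA'])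
  · rw [h.1 hnu, h'.1 hnu]

theorem localRule_of_le_right (h : lam ≤ mu) (hw : ¬ w) : LocalRule lam lam mu w mu :=
  ⟨fun _ => (sup_eq_right.2 h).symm, fun _ hmu _ => hmu, fun _ _ hw' => absurd hw' hw,
    fun hlam hmu => absurd hlam.symm hmu⟩

theorem localRule_of_le_left (h : lam ≤ nu) (hw : ¬ w) : LocalRule lam nu lam w nu :=
  ⟨fun _ => (sup_eq_left.2 h).symm, fun hnu _ _ => hnu, fun _ _ hw' => absurd hw' hw,
    fun _ hlam => absurd rfl hlam⟩

theorem localRule_of_addsBox (h : AddsBox lam b rho) (hb : b.1 = 0) (hw : w) :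
    LocalRule lam lam lam w rho :=
  ⟨fun hne => absurd rfl hne, fun _ _ hw' => absurd hw hw', fun _ _ _ => ⟨b, hb, h⟩,
    fun _ hlam => absurd rfl hlam⟩

end LocalRule

section ConjugateOrder

variable {α : Type*} [PartialOrder α] {R : α → α → Prop}

/-- A strict order whose comparable pairs are the incomparable pairs of the given partial order.
Exchange arguments for antichains then apply to chains, which are the antichains of `R`. -/
structure IsConjugateOrder (R : α → α → Prop) : Prop extends IsStrictOrder α R where
  rel_or_rel_iff : ∀ x y, R x y ∨ R y x ↔ IncompRel (· ≤ ·) x y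

theorem IsConjugateOrder.swap (hR : IsConjugateOrder R) : IsConjugateOrder (Function.swap R) where
  toIsStrictOrder := have := hR.toIsStrictOrder; inferInstance
  rel_or_rel_iff x y := or_comm.trans (hR.rel_or_rel_iff x y)

theorem IsConjugateOrder.chainNum_eq (hR : IsConjugateOrder R) (P : Finset α) (k : ℕ) :
    chainNum P k = colorNum R P k := by
  rw [chainNum_eq_colorNum]
  refine colorNum_congr fun x y => ?_
  rw [hR.rel_or_rel_iff, incompRel_comm (a := y), or_self]

variable [DecidableEq α] {Q : Finset α} {p q : α}

theorem IsConjugateOrder.exists_addsBox_insert (hR : IsConjugateOrder R) (hp : p ∉ Q)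
    (hmin : ∀ x ∈ Q, ¬ R x p) : ∃ b, AddsBox (shape Q) b (shape (insert p Q)) := by
  have := hR.toIsStrictOrder
  refine exists_addsBox_of_chainNum hp fun k => ?_
  simpa only [hR.chainNum_eq] using colorNum_insert_add_colorNum_le hp hmin k.le_succ

/-- A new greatest element extends a longest chain. -/
theorem exists_addsBox_insert_of_forall_le (hp : p ∉ Q) (hmax : ∀ x ∈ Q, x ≤ p) :
    ∃ b, b.1 = 0 ∧ AddsBox (shape Q) b (shape (insert p Q)) := by
  have hsucc : ∀ k, chainNum (insert p Q) (k + 1) = chainNum Q (k + 1) + 1 := fun k => by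
    rw [chainNum_eq_colorNum, chainNum_eq_colorNum, colorNum_insert_of_unrelated hp]
    intro x hx
    have hxp : x ≤ p := (Finset.mem_insert.1 hx).elim le_of_eq (hmax x)
    exact ⟨fun h => h.1 hxp, fun h => h.2 hxp⟩
  obtain ⟨b, hb⟩ := exists_addsBox_of_chainNum hp fun k => by
    have hle : chainNum (insert p Q) k ≤ chainNum Q k + 1 := by
      simpa only [chainNum_eq_colorNum] using colorNum_insert_le p
    rw [hsucc]
    omega
  refine ⟨b, ?_, hb⟩
  by_contra hrow
  have hone := hb.chainNum_eq (0 + 1)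
  rw [hsucc, if_neg (by omega)] at hone
  omega

/-- The new box lies below the row of the old one by an exchange of antichains and at most one row
below by an exchange of chains. -/
theorem IsConjugateOrder.row_eq_succ {a c : ℕ × ℕ} (hR : IsConjugateOrder R) (hp : p ∉ Q)
    (hq : q ∉ Q) (hpq : p ≠ q) (hp_max : ∀ x ∈ insert q Q, ¬ p < x)
    (hq_max : ∀ x ∈ insert p Q, ¬ q < x) (hpR : ∀ x ∈ insert q Q, ¬ R p x)
    (hqR : ∀ x ∈ insert p Q, ¬ R x q) (ha : AddsBox (shape Q) a (shape (insert p Q)))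
    (heq : shape (insert p Q) = shape (insert q Q))
    (hc : AddsBox (shape (insert q Q)) c (shape (insert p (insert q Q)))) : c.1 = a.1 + 1 := by
  have := hR.toIsStrictOrder
  have ha' : AddsBox (shape Q) a (shape (insert q Q)) := heq ▸ ha
  have hc' : AddsBox (shape (insert p Q)) c (shape (insert p (insert q Q))) := heq ▸ hc
  have hrow : c.1 ≤ a.1 + 1 := by
    have hexch := colorNum_insert_add_colorNum_insert_le (R := R) hq hp hpq.symm
      (Nat.le_add_right (a.1 + 1) 1) hqR (Or.inr ⟨Nat.lt_succ_self _, hpR⟩)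
    rw [Finset.insert_comm] at hexch
    simp only [← hR.chainNum_eq, ha'.chainNum_eq (a.1 + 1), hc'.chainNum_eq (a.1 + 1 + 1)] at hexch
    split_ifs at hexch <;> omega
  have hcol : c.2 ≤ a.2 := by
    have hexch := colorNum_insert_add_colorNum_insert_le (R := (· > ·)) hp hq hpq
      (le_refl (a.2 + 1)) hp_max (Or.inl hq_max)
    have hgt : ∀ P : Finset α, colorNum (· > ·) P (a.2 + 1) = antichainNum P (a.2 + 1) := by
      intro P
      rw [antichainNum_eq_colorNum]
      exact colorNum_congr fun x y => or_comm
    simp only [hgt, ha.antichainNum_eq (a.2 + 1), hc.antichainNum_eq (a.2 + 1)] at hexch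
    split_ifs at hexch <;> omega
  have hrow' : a.1 < c.1 := hc.row_lt_of_col_le (ha'.mem_iff.2 (Or.inl rfl)) hcol
  omega

theorem IsConjugateOrder.localRule_insert_insert {w : Prop} (hR : IsConjugateOrder R) (hp : p ∉ Q)
    (hq : q ∉ Q) (hpq : p ≠ q) (hp_max : ∀ x ∈ insert q Q, ¬ p < x)
    (hq_max : ∀ x ∈ insert p Q, ¬ q < x) (hpR : ∀ x ∈ insert q Q, ¬ R p x)
    (hqR : ∀ x ∈ insert p Q, ¬ R x q) :
    LocalRule (shape Q) (shape (insert p Q)) (shape (insert q Q)) w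
      (shape (insert p (insert q Q))) := by
  obtain ⟨a, ha⟩ := hR.swap.exists_addsBox_insert hp fun x hx =>
    hpR x (Finset.mem_insert_of_mem hx)
  obtain ⟨b, hb⟩ := hR.exists_addsBox_insert hq fun x hx => hqR x (Finset.mem_insert_of_mem hx)
  obtain ⟨c, hc⟩ := hR.swap.exists_addsBox_insert (Q := insert q Q) (p := p)
    (by simp [hp, hpq]) hpR
  obtain ⟨d, hd⟩ := hR.exists_addsBox_insert (Q := insert p Q) (p := q)
    (by simp [hq, hpq.symm]) hqR
  rw [Finset.insert_comm] at hd
  refine ⟨fun hne => ha.eq_sup hb hne hd hc, fun _ h => absurd h hb.ne, fun _ h => absurd h hb.ne,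
    fun heq _ => ⟨a, c, heq ▸ ha, ?_, hc⟩⟩
  exact hR.row_eq_succ hp hq hpq hp_max hq_max hpR hqR ha heq hc

end ConjugateOrder

section Growth

/-- The relation of lying to the northwest in the plane, a strict order whose comparable pairs are
the incomparable pairs of the product order. -/
def Northwest (x y : ℕ × ℕ) : Prop := x.1 < y.1 ∧ y.2 < x.2

theorem isConjugateOrder_northwest : IsConjugateOrder Northwest where
  irrefl x h := lt_irrefl _ h.1
  trans x y z hxy hyz := ⟨hxy.1.trans hyz.1, hyz.2.trans hxy.2⟩
  rel_or_rel_iff x y := by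
    simp only [Northwest, IncompRel, Prod.le_def]
    omega

variable {n : ℕ} (σ : Equiv.Perm (Fin n))

theorem mem_permIdeal {i j : ℕ} {x : ℕ × ℕ} :
    x ∈ permIdeal σ i j ↔ ∃ k : Fin n, (k : ℕ) < i ∧ (σ k : ℕ) < j ∧
      ((k : ℕ) + 1, (σ k : ℕ) + 1) = x := by
  simp only [permIdeal, permPoset, Finset.mem_inter, Finset.mem_product, Finset.mem_Icc,
    Finset.mem_image, Finset.mem_univ, true_and]
  constructor
  · rintro ⟨h, k, rfl⟩
    exact ⟨k, by omega, by omega, rfl⟩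
  · rintro ⟨k, hi, hj, rfl⟩
    exact ⟨by omega, k, rfl⟩

theorem le_of_mem_permIdeal {i j : ℕ} {x : ℕ × ℕ} (hx : x ∈ permIdeal σ i j) :
    x.1 ≤ i ∧ x.2 ≤ j := by
  obtain ⟨k, hi, hj, rfl⟩ := (mem_permIdeal σ).1 hx
  exact ⟨hi, hj⟩

theorem permIdeal_succ_left_of_lt (i : Fin n) {j : ℕ} (h : (σ i : ℕ) < j) :
    permIdeal σ (i + 1) j = insert ((i : ℕ) + 1, (σ i : ℕ) + 1) (permIdeal σ i j) := by
  ext x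
  rw [Finset.mem_insert, mem_permIdeal, mem_permIdeal]
  constructor
  · rintro ⟨k, hi, hj, rfl⟩
    rcases Nat.lt_succ_iff_lt_or_eq.1 hi with hi | hi
    · exact Or.inr ⟨k, hi, hj, rfl⟩
    · exact Or.inl (by rw [Fin.ext hi])
  · rintro (rfl | ⟨k, hi, hj, rfl⟩)
    · exact ⟨i, Nat.lt_succ_self _, h, rfl⟩
    · exact ⟨k, hi.trans (Nat.lt_succ_self _), hj, rfl⟩

theorem permIdeal_succ_left_of_le (i : Fin n) {j : ℕ} (h : j ≤ (σ i : ℕ)) :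
    permIdeal σ (i + 1) j = permIdeal σ i j := by
  ext x
  rw [mem_permIdeal, mem_permIdeal]
  refine exists_congr fun k => and_congr_left fun ⟨hj, _⟩ => ?_
  have : (k : ℕ) ≠ i := fun he => by
    rw [Fin.ext he] at hj
    omega
  omega

theorem permIdeal_succ_right_of_lt {i : ℕ} (j : Fin n) (h : (σ.symm j : ℕ) < i) :
    permIdeal σ i (j + 1) = insert ((σ.symm j : ℕ) + 1, (j : ℕ) + 1) (permIdeal σ i j) := by
  ext x
  rw [Finset.mem_insert, mem_permIdeal, mem_permIdeal]
  constructor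
  · rintro ⟨k, hi, hj, rfl⟩
    rcases Nat.lt_succ_iff_lt_or_eq.1 hj with hj | hj
    · exact Or.inr ⟨k, hi, hj, rfl⟩
    · exact Or.inl (by rw [← Fin.ext hj, Equiv.symm_apply_apply])
  · rintro (rfl | ⟨k, hi, hj, rfl⟩)
    · exact ⟨σ.symm j, h, by simp, by simp⟩
    · exact ⟨k, hi, hj.trans (Nat.lt_succ_self _), rfl⟩

theorem permIdeal_succ_right_of_le {i : ℕ} (j : Fin n) (h : i ≤ (σ.symm j : ℕ)) :
    permIdeal σ i (j + 1) = permIdeal σ i j := by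
  ext x
  rw [mem_permIdeal, mem_permIdeal]
  refine exists_congr fun k => and_congr_right fun hi => and_congr_left fun _ => ?_
  have : (σ k : ℕ) ≠ j := fun he => by
    rw [← Fin.ext he, Equiv.symm_apply_apply] at h
    omega
  omega

theorem growth_le_succ_left (i : Fin n) (j : ℕ) : growth σ i j ≤ growth σ (i + 1) j := by
  rcases Nat.lt_or_ge (σ i) j with h | h
  · obtain ⟨b, hb⟩ := isConjugateOrder_northwest.swap.exists_addsBox_insert
      (Q := permIdeal σ i j) (p := ((i : ℕ) + 1, (σ i : ℕ) + 1))
      (fun hp => absurd (le_of_mem_permIdeal σ hp).1 (by simp))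
      (fun x hx hR => absurd hR.1 (by have := le_of_mem_permIdeal σ hx; simp; omega))
    rw [growth, growth, permIdeal_succ_left_of_lt σ i h]
    exact hb.le
  · rw [growth, growth, permIdeal_succ_left_of_le σ i h]

theorem growth_le_succ_right (i : ℕ) (j : Fin n) : growth σ i j ≤ growth σ i (j + 1) := by
  rcases Nat.lt_or_ge (σ.symm j) i with h | h
  · obtain ⟨b, hb⟩ := isConjugateOrder_northwest.exists_addsBox_insert
      (Q := permIdeal σ i j) (p := ((σ.symm j : ℕ) + 1, (j : ℕ) + 1))
      (fun hp => absurd (le_of_mem_permIdeal σ hp).2 (by simp))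
      (fun x hx hR => absurd hR.2 (by have := le_of_mem_permIdeal σ hx; simp; omega))
    rw [growth, growth, permIdeal_succ_right_of_lt σ j h]
    exact hb.le
  · rw [growth, growth, permIdeal_succ_right_of_le σ j h]

theorem exists_addsBox_growth_of_apply_eq {i j : Fin n} (h : σ i = j) :
    ∃ b, b.1 = 0 ∧ AddsBox (growth σ i j) b (growth σ (i + 1) (j + 1)) := by
  rw [growth, growth, permIdeal_succ_left_of_lt σ i (by simp [h]),
    permIdeal_succ_right_of_le σ j (by simp [← h])]
  refine exists_addsBox_insert_of_forall_le (fun hp => ?_) fun x hx => ?_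
  · exact absurd (le_of_mem_permIdeal σ hp).1 (by simp)
  · have := le_of_mem_permIdeal σ hx
    simp only [h, Prod.le_def]
    omega

theorem localRule_growth_of_lt {i j : Fin n} {w : Prop} (hi : (σ i : ℕ) < j)
    (hj : (σ.symm j : ℕ) < i) :
    LocalRule (growth σ i j) (growth σ (i + 1) j) (growth σ i (j + 1)) w
      (growth σ (i + 1) (j + 1)) := by
  simp only [growth]
  rw [permIdeal_succ_left_of_lt σ i (hi.trans (Nat.lt_succ_self (j : ℕ))),
    permIdeal_succ_left_of_lt σ i hi, permIdeal_succ_right_of_lt σ j hj]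
  have hbound := fun x hx => le_of_mem_permIdeal σ (i := i) (j := j) (x := x) hx
  refine isConjugateOrder_northwest.localRule_insert_insert
    (fun hp => absurd (hbound _ hp).1 (by simp)) (fun hq => absurd (hbound _ hq).2 (by simp))
    (by simp; omega) ?_ ?_ ?_ ?_ <;>
  · simp only [Finset.forall_mem_insert, Northwest, Prod.lt_iff]
    refine ⟨by omega, fun x hx => ?_⟩
    have := hbound x hx
    omega

theorem localRule_growth (i j : Fin n) :
    LocalRule (growth σ i j) (growth σ (i + 1) j) (growth σ i (j + 1)) (σ i = j)
      (growth σ (i + 1) (j + 1)) := by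
  by_cases hij : σ i = j
  · obtain ⟨b, hb, hadd⟩ := exists_addsBox_growth_of_apply_eq σ hij
    have hsouth : growth σ (i + 1) j = growth σ i j :=
      congrArg shape (permIdeal_succ_left_of_le σ i (by simp [hij]))
    have hwest : growth σ i (j + 1) = growth σ i j :=
      congrArg shape (permIdeal_succ_right_of_le σ j (by simp [← hij]))
    rw [hsouth, hwest]
    exact localRule_of_addsBox hadd hb hij
  have hi_ne : (σ i : ℕ) ≠ j := fun h => hij (Fin.ext h)
  have hj_ne : (σ.symm j : ℕ) ≠ i := fun h => hij (by rw [← Fin.ext h, Equiv.apply_symm_apply])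
  rcases Nat.lt_or_gt_of_ne hi_ne with hi | hi
  · rcases Nat.lt_or_gt_of_ne hj_ne with hj | hj
    · exact localRule_growth_of_lt σ hi hj
    · have hwest : growth σ i (j + 1) = growth σ i j :=
        congrArg shape (permIdeal_succ_right_of_le σ j hj.le)
      have heast : growth σ (i + 1) (j + 1) = growth σ (i + 1) j :=
        congrArg shape (permIdeal_succ_right_of_le σ j hj)
      rw [hwest, heast]
      exact localRule_of_le_left (growth_le_succ_left σ i j) hij
  · have hsouth : growth σ (i + 1) j = growth σ i j :=
      congrArg shape (permIdeal_succ_left_of_le σ i hi.le)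
    have hnorth : growth σ (i + 1) (j + 1) = growth σ i (j + 1) :=
      congrArg shape (permIdeal_succ_left_of_le σ i hi)
    rw [hsouth, hnorth]
    exact localRule_of_le_right (growth_le_succ_right σ i j) hij

end Growth

end Greene

/-- For `i j : Fin n` the unit square has corners `(i, j)` and `(i + 1, j + 1)`, and `σ i = j` says
that the permutation of `{1, …, n}` sends `i + 1` to `j + 1`. Row `0` is the first row. -/
theorem theorem3p1 :
    -- every entry of every growth diagram is a genuine shape
    (∀ (n : ℕ) (σ : Equiv.Perm (Fin n)) (i j : ℕ), i ≤ n → j ≤ n →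
      Greene.IsShape (Greene.permIdeal σ i j) (Greene.growth σ i j)) ∧
    -- one universal local rule determines the northeast corner
    (∃ F : YoungDiagram → YoungDiagram → YoungDiagram → Prop → YoungDiagram,
      ∀ (n : ℕ) (σ : Equiv.Perm (Fin n)) (i j : Fin n),
        Greene.growth σ (i + 1) (j + 1) =
          F (Greene.growth σ i j) (Greene.growth σ (i + 1) j) (Greene.growth σ i (j + 1))
            (σ i = j)) ∧
    -- the four explicit rules
    (∀ (n : ℕ) (σ : Equiv.Perm (Fin n)) (i j : Fin n),
      (Greene.growth σ (i + 1) j ≠ Greene.growth σ i (j + 1) →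
        Greene.growth σ (i + 1) (j + 1) =
          Greene.growth σ (i + 1) j ⊔ Greene.growth σ i (j + 1)) ∧
      (Greene.growth σ (i + 1) j = Greene.growth σ i (j + 1) →
        Greene.growth σ i (j + 1) = Greene.growth σ i j →
        σ i ≠ j →
        Greene.growth σ (i + 1) (j + 1) = Greene.growth σ i j) ∧
      (Greene.growth σ (i + 1) j = Greene.growth σ i (j + 1) →
        Greene.growth σ i (j + 1) = Greene.growth σ i j →
        σ i = j →
        ∃ B : ℕ × ℕ, B.1 = 0 ∧
          Greene.AddsBox (Greene.growth σ i j) B (Greene.growth σ (i + 1) (j + 1))) ∧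
      (Greene.growth σ (i + 1) j = Greene.growth σ i (j + 1) →
        Greene.growth σ i (j + 1) ≠ Greene.growth σ i j →
        ∃ A B : ℕ × ℕ,
          Greene.AddsBox (Greene.growth σ i j) A (Greene.growth σ i (j + 1)) ∧
          B.1 = A.1 + 1 ∧
          Greene.AddsBox (Greene.growth σ i (j + 1)) B (Greene.growth σ (i + 1) (j + 1)))) := by
  classical
  refine ⟨fun n σ i j _ _ => Greene.isShape_shape _,
    ⟨fun lam nu mu w => if h : ∃ rho, Greene.LocalRule lam nu mu w rho then h.choose else ⊥,
      fun n σ i j => ?_⟩, fun n σ i j => Greene.localRule_growth σ i j⟩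
  have h : ∃ rho, Greene.LocalRule (Greene.growth σ i j) (Greene.growth σ (i + 1) j)
      (Greene.growth σ i (j + 1)) (σ i = j) rho := ⟨_, Greene.localRule_growth σ i j⟩
  beta_reduce
  rw [dif_pos h]
  exact (Greene.localRule_growth σ i j).unique h.choose_spec
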